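/- An MV-algebra is an algebra $(N;\oplus,{}^*,0,1)$ such that $(N;\oplus,0)$ is a commutative monoid, $0^*=1$, and for all $x,y\in N$: $x^{**}=x$, $x\oplus 1=1$ and $x\oplus(x\oplus y^*)^*=y\oplus(y\oplus x^*)^*$. It is a distributive lattice with $x\le y$ iff $x^*\oplus y=1$, where $x\vee y=(x^*\oplus y)^*\oplus y$ and $x\wedge y=(x^*\oplus(x^*\oplus y)^*)^*$. An EMV-algebra is an algebra $(M;\vee,\wedge,\oplus,0)$ such that $(M;\vee,\wedge,0)$ is a distributive lattice with bottom element $0$; $(M;\oplus,0)$ is a commutative ordered monoid (that is, $x\le y$ implies $x\oplus z\le y\oplus z$); for each idempotent $a$ (that is, $a\oplus a=a$) and each $x\in[0,a]$ the element $\lambda_a(x)=\min\{z\in[0,a] : z\oplus x=a\}$ exists and $([0,a];\oplus,\lambda_a,0,a)$ is an MV-algebra; and each element of $M$ lies below some idempotent. Every MV-algebra is an EMV-algebra with respect to its lattice operations, $\oplus$ and $0$, and in it $\lambda_1(x)=x^*$. An EMV-homomorphism is a map $f$ that preserves $\vee,\wedge,\oplus,0$ and satisfies $f(\lambda_b(x))=\lambda_{f(b)}(f(x))$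 for each idempotent $b$ and each $x\le b$. An EMV-algebra (in particular, an MV-algebra) is $\sigma$-complete if each sequence of its elements has a least upper bound in it. An ideal is a nonempty subset $I$ that is closed downwards and closed under $\oplus$; it is maximal if it is maximal by inclusion among the proper ideals, and it is $\sigma$-complete (a $\sigma$-ideal) if, for each sequence $(x_n)$ in $I$ whose supremum exists in the algebra, $\bigvee_n x_n\in I$. Theorem. Let $M$ be a $\sigma$-complete EMV-algebra without a top element. Then there are a $\sigma$-complete MV-algebra $N$ and an injective EMV-homomorphism $f:M\to N$ whose image $f(M)$ is a maximal ideal of $N$ and a $\sigma$-complete ideal of $N$, and such that each $x\in N$ either lies in $f(M)$ or is of the form $x=\lambda_1(f(y))$ for some $y\in M$. -/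

import Mathlib

universe u v

/-- An MV-algebra `(N; ⊕, *, 0, 1)`. The operation `⊕` is written `+`, and `x*` is written `xᶜ`. -/
class MVAlgebra (N : Type u) extends AddCommMonoid N, One N, Compl N where
  compl_compl' : ∀ x : N, xᶜᶜ = x
  compl_zero' : (0 : N)ᶜ = 1
  add_one' : ∀ x : N, x + 1 = 1
  luk : ∀ x y : N, x + (x + yᶜ)ᶜ = y + (y + xᶜ)ᶜ

/-- An EMV-algebra `(M; ∨, ∧, ⊕, 0)`, with `⊕` written `+`: a distributive lattice with bottom
element `0` and a commutative ordered monoid, such that for each idempotent `a` the interval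
`[0, a]` is an MV-algebra under `⊕`, `λ_a`, `0`, `a`, where
`λ_a x = min {z ∈ [0, a] | z ⊕ x = a}`, and each element lies below an idempotent. -/
class EMVAlgebra (M : Type u) extends DistribLattice M, AddCommMonoid M where
  zero_le' : ∀ x : M, 0 ≤ x
  add_mono' : ∀ x y z : M, x ≤ y → x + z ≤ y + z
  interval_mv : ∀ a : M, a + a = a → ∃ A : MVAlgebra (Set.Icc (0 : M) a),
    (∀ x y : Set.Icc (0 : M) a, ((A.add x y : Set.Icc (0 : M) a) : M) = (x : M) + (y : M)) ∧
    ((A.zero : Set.Icc (0 : M) a) : M) = 0 ∧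
    ((A.one : Set.Icc (0 : M) a) : M) = a ∧
    ∀ x : Set.Icc (0 : M) a,
      IsLeast {z : M | z ∈ Set.Icc (0 : M) a ∧ z + (x : M) = a}
        ((A.compl x : Set.Icc (0 : M) a) : M)
  exists_idem : ∀ x : M, ∃ a : M, a + a = a ∧ x ≤ a

namespace MVAlgebra

variable {N : Type u} [MVAlgebra N]

theorem compl_one' : (1 : N)ᶜ = 0 := by rw [← compl_zero', compl_compl']

theorem add_compl (x : N) : x + xᶜ = 1 := by
  have h := luk x 1
  rw [compl_one', add_zero, add_comm (1 : N), add_one'] at h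
  exact h

/-- The natural order of an MV-algebra, `x ≤ y ↔ x* ⊕ y = 1`. -/
def le' (x y : N) : Prop := xᶜ + y = 1

theorem le'_refl (x : N) : le' x x := by
  unfold le'
  rw [add_comm, add_compl]

theorem le'_add (x z : N) : le' x (x + z) := by
  unfold le'
  rw [← add_assoc, add_comm xᶜ x, add_compl, add_comm, add_one']

theorem le'_eq {x y : N} (h : le' x y) : x + (x + yᶜ)ᶜ = y := by
  unfold le' at h
  rw [luk, add_comm y xᶜ, h, compl_one', add_zero]

theorem le'_trans {x y z : N} (h : le' x y) (k : le' y z) : le' x z := by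
  rw [← le'_eq k, ← le'_eq h, add_assoc]
  exact le'_add _ _

theorem le'_antisymm {x y : N} (h : le' x y) (k : le' y x) : x = y := by
  have h1 := le'_eq h
  unfold le' at k
  rwa [add_comm x yᶜ, k, compl_one', add_zero] at h1

theorem le'_add_mono {x y : N} (h : le' x y) (z : N) : le' (x + z) (y + z) := by
  rw [← le'_eq h, add_right_comm]
  exact le'_add _ _

theorem le'_compl {x y : N} (h : le' x y) : le' yᶜ xᶜ := by
  unfold le' at *
  rwa [compl_compl', add_comm]

theorem le'_sup_right (x y : N) : le' y ((xᶜ + y)ᶜ + y) := by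
  rw [add_comm _ y]
  exact le'_add _ _

theorem sup_symm (x y : N) : (xᶜ + y)ᶜ + y = (yᶜ + x)ᶜ + x := by
  rw [add_comm xᶜ y, add_comm yᶜ x, add_comm _ y, add_comm _ x, luk]

theorem le'_sup_left (x y : N) : le' x ((xᶜ + y)ᶜ + y) := by
  rw [sup_symm]
  exact le'_sup_right _ _

theorem sup_le' {x y z : N} (h : le' x z) (k : le' y z) : le' ((xᶜ + y)ᶜ + y) z := by
  have h1 := le'_add_mono (le'_compl (le'_add_mono (le'_compl h) y)) y
  rwa [add_comm zᶜ y, add_comm (y + zᶜ)ᶜ y, le'_eq k] at h1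

theorem le'_compl_left {x y : N} (h : le' xᶜ y) : le' yᶜ x := by
  have h1 := le'_compl h
  rwa [compl_compl'] at h1

theorem le'_compl_right {x y : N} (h : le' x yᶜ) : le' y xᶜ := by
  have h1 := le'_compl h
  rwa [compl_compl'] at h1

/-- `x ⊙ t ≤ w ↔ x ≤ t* ⊕ w`. -/
theorem odot_le' {x t w : N} : le' (xᶜ + tᶜ)ᶜ w ↔ le' x (tᶜ + w) := by
  unfold le'
  rw [compl_compl', add_assoc]

/-- The lattice structure of an MV-algebra: `x ∨ y = (x ⊖ y) ⊕ y` and `x ∧ y = x ⊙ (x* ⊕ y)`. -/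
instance instLattice : Lattice N where
  le := le'
  le_refl := le'_refl
  le_trans _ _ _ := le'_trans
  le_antisymm _ _ := le'_antisymm
  sup x y := (xᶜ + y)ᶜ + y
  inf x y := (xᶜ + (xᶜ + y)ᶜ)ᶜ
  le_sup_left := le'_sup_left
  le_sup_right := le'_sup_right
  sup_le _ _ _ := sup_le'
  inf_le_left x y := le'_compl_left (le'_add _ _)
  inf_le_right x y := by
    have h := luk xᶜ yᶜ
    rw [compl_compl', compl_compl'] at h
    rw [h]
    exact le'_compl_left (le'_add _ _)
  le_inf x y z h k := by
    have h1 := sup_le' (le'_compl k) (le'_compl h)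
    rw [compl_compl', add_comm z, add_comm _ yᶜ] at h1
    exact le'_compl_right h1

theorem le_def (x y : N) : x ≤ y ↔ xᶜ + y = 1 := Iff.rfl

theorem sup_def (x y : N) : x ⊔ y = (xᶜ + y)ᶜ + y := rfl

theorem inf_def (x y : N) : x ⊓ y = (xᶜ + (xᶜ + y)ᶜ)ᶜ := rfl

theorem inf_sup_le (x y z : N) : x ⊓ (y ⊔ z) ≤ (x ⊓ y) ⊔ (x ⊓ z) := by
  have key : ∀ b s w : N, b ≤ s → x ⊓ b ≤ w → b ≤ (sᶜ + x)ᶜ + w := by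
    intro b s w hb hw
    have h1 : b ≤ (bᶜ + x)ᶜ + w := by
      rw [inf_comm, inf_def] at hw
      have h2 := (odot_le' (x := b) (t := bᶜ + x) (w := w)).1 hw
      exact h2
    refine le_trans h1 ?_
    exact le'_add_mono (le'_compl (le'_add_mono (le'_compl hb) x)) w
  rw [inf_comm x (y ⊔ z), inf_def (y ⊔ z) x]
  refine (odot_le' (x := y ⊔ z)).2 ?_
  exact sup_le (key _ _ _ le_sup_left le_sup_left) (key _ _ _ le_sup_right le_sup_right)

theorem zero_le_mv (x : N) : 0 ≤ x := by
  rw [le_def, compl_zero', add_comm, add_one']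

theorem add_le_idem {a x y : N} (ha : a + a = a) (hx : x ≤ a) (hy : y ≤ a) : x + y ≤ a := by
  have h1 : x + y ≤ a + y := le'_add_mono hx y
  have h2 : y + a ≤ a + a := le'_add_mono hy a
  rw [ha, add_comm] at h2
  exact le_trans h1 h2

/-- The commutative monoid `([0, a]; ⊕, 0)` for an idempotent `a` of an MV-algebra. -/
abbrev intervalMonoid (a : N) (ha : a + a = a) : AddCommMonoid (Set.Icc (0 : N) a) :=
  letI : Zero (Set.Icc (0 : N) a) := ⟨⟨0, le_refl _, zero_le_mv a⟩⟩
  letI : Add (Set.Icc (0 : N) a) :=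
    ⟨fun x y => ⟨x.1 + y.1, zero_le_mv _, add_le_idem ha x.2.2 y.2.2⟩⟩
  { add_assoc := fun _ _ _ => Subtype.ext (add_assoc _ _ _)
    zero_add := fun _ => Subtype.ext (zero_add _)
    add_zero := fun _ => Subtype.ext (add_zero _)
    add_comm := fun _ _ => Subtype.ext (add_comm _ _)
    nsmul := nsmulRec }

/-- The MV-algebra `[0, a]` for an idempotent `a` of an MV-algebra, with `λ_a x = a ⊙ x*`. -/
abbrev interval (a : N) (ha : a + a = a) : MVAlgebra (Set.Icc (0 : N) a) where
  toAddCommMonoid := intervalMonoid a ha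
  one := ⟨a, zero_le_mv a, le_refl _⟩
  compl x := ⟨(aᶜ + x.1)ᶜ, zero_le_mv _, le'_compl_left (le'_add _ _)⟩
  compl_compl' x := Subtype.ext (inf_eq_right.2 x.2.2 : a ⊓ x.1 = x.1)
  compl_zero' := Subtype.ext (by
    change (aᶜ + 0)ᶜ = a
    rw [add_zero, compl_compl'])
  add_one' x := Subtype.ext (by
    change x.1 + a = a
    refine le_antisymm ?_ ?_
    · conv_rhs => rw [← ha]
      exact le'_add_mono x.2.2 a
    · rw [add_comm]
      exact le'_add _ _)
  luk x y := Subtype.ext (by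
    have key : ∀ p q : Set.Icc (0 : N) a,
        aᶜ + (p.1 + (aᶜ + q.1)ᶜ) = p.1 + q.1ᶜ := by
      intro p q
      have h := luk aᶜ q.1ᶜ
      have hq : q.1ᶜ + aᶜᶜ = 1 := by rw [compl_compl']; exact q.2.2
      rw [compl_compl', hq, compl_one', add_zero] at h
      rw [add_left_comm, h]
    change x.1 + (aᶜ + (x.1 + (aᶜ + y.1)ᶜ))ᶜ = y.1 + (aᶜ + (y.1 + (aᶜ + x.1)ᶜ))ᶜ
    rw [key, key, luk])

/-- Every MV-algebra is an EMV-algebra. -/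
instance instEMVAlgebra : EMVAlgebra N where
  le_sup_inf := (DistribLattice.ofInfSupLe (α := N) inf_sup_le).le_sup_inf
  zero_le' x := by rw [le_def, compl_zero', add_comm, add_one']
  add_mono' _ _ z h := le'_add_mono h z
  interval_mv a ha := ⟨interval a ha, fun _ _ => rfl, rfl, rfl, fun x =>
    ⟨⟨((interval a ha).compl x).2, by
      exact (sup_eq_left.2 x.2.2 : a ⊔ x.1 = a)⟩, fun z hz => by
      change le' (aᶜ + x.1)ᶜ z
      unfold le'
      have h1 := hz.2
      rw [add_comm] at h1
      rw [compl_compl', add_assoc, h1, add_comm, add_compl]⟩⟩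
  exists_idem x := ⟨1, add_one' 1, add_one' _⟩

end MVAlgebra

namespace EMVAlgebra

section

variable {M : Type u} [EMVAlgebra M]

open Classical in
/-- `lam a x` is `λ_a x`, the least `z ∈ [0, a]` with `z ⊕ x = a`. It is used only for `a`
idempotent and `x ≤ a`, where this least element exists. -/
noncomputable def lam (a x : M) : M :=
  if h : ∃ w : M, IsLeast {z : M | z ∈ Set.Icc (0 : M) a ∧ z + x = a} w then h.choose else 0

theorem lam_isLeast {a x : M} (ha : a + a = a) (hx : x ≤ a) :
    IsLeast {z : M | z ∈ Set.Icc (0 : M) a ∧ z + x = a} (lam a x) := by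
  obtain ⟨A, -, -, -, h⟩ := interval_mv a ha
  have hex : ∃ w : M, IsLeast {z : M | z ∈ Set.Icc (0 : M) a ∧ z + x = a} w :=
    ⟨_, h ⟨x, zero_le' x, hx⟩⟩
  unfold lam
  rw [dif_pos hex]
  exact hex.choose_spec

/-- An ideal: a nonempty lower set closed under `⊕`. -/
structure IsIdeal (I : Set M) : Prop where
  nonempty : I.Nonempty
  mem_of_le : ∀ x y : M, x ≤ y → y ∈ I → x ∈ I
  add_mem : ∀ x y : M, x ∈ I → y ∈ I → x + y ∈ I

/-- A maximal ideal: maximal, with respect to inclusion, among the proper ideals. -/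
def IsMaximalIdeal (I : Set M) : Prop :=
  Maximal (fun J : Set M => IsIdeal J ∧ J ≠ Set.univ) I

/-- A `σ`-complete ideal (`σ`-ideal): an ideal that contains each existing supremum of a sequence
of its elements. -/
def IsSigmaIdeal (I : Set M) : Prop :=
  IsIdeal I ∧ ∀ x : ℕ → M, (∀ n, x n ∈ I) → ∀ s : M, IsLUB (Set.range x) s → s ∈ I

variable (M) in
/-- `σ`-completeness: each sequence has a least upper bound. -/
def SigmaComplete : Prop := ∀ x : ℕ → M, ∃ s : M, IsLUB (Set.range x) s

end

/-- Homomorphisms of EMV-algebras. -/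
structure IsHom {M : Type u} {N : Type v} [EMVAlgebra M] [EMVAlgebra N] (f : M → N) : Prop where
  map_sup : ∀ x y : M, f (x ⊔ y) = f x ⊔ f y
  map_inf : ∀ x y : M, f (x ⊓ y) = f x ⊓ f y
  map_add : ∀ x y : M, f (x + y) = f x + f y
  map_zero : f 0 = 0
  map_lam : ∀ b x : M, b + b = b → x ≤ b → f (lam b x) = lam (f b) (f x)

end EMVAlgebra

/-- In an MV-algebra `λ_1 x = x*`. -/
theorem MVAlgebra.lam_one {N : Type u} [MVAlgebra N] (x : N) :
    EMVAlgebra.lam (1 : N) x = xᶜ := by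
  have h := EMVAlgebra.lam_isLeast (a := (1 : N)) (x := x) (add_one' 1) (add_one' _)
  refine h.unique ⟨⟨⟨EMVAlgebra.zero_le' _, add_one' _⟩, ?_⟩, fun z hz => ?_⟩
  · rw [add_comm]
    exact add_compl x
  · rw [le_def, compl_compl', add_comm]
    exact hz.2

/-! Take N to be M together with a formal complement y* of each y in M. The MV-laws dictate x ⊕ y* =
(y ⊖ x)* and x* ⊕ y* = (x ⊙ y)*, so the task is to define ⊖ and ⊙ on all of M. The difference has an
order characterization (`diff_le`) that does not depend on the interval [0, a] used to compute it
(`exists_sub`), and ⊙ is a term in ⊕ and ⊖. Any three elements lie in one MV-algebra [0, a]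
(`exists_chart_three`), where the identities needed for the MV-axioms of N are checked. M is a lower
set of N closed under ⊕, and it is maximal because y ⊕ y* = 1. Suprema in M remain suprema in N
(`isLUB_range_of`); if a sequence contains a complement, its supremum is the complement of a bounded
infimum in M (`exists_isGLB_of_le`). -/

namespace EMVAlgebra

/-! ### Truncated difference and Łukasiewicz product on an EMV-algebra -/

section Difference

variable {M : Type u} [EMVAlgebra M]

theorem le_add_right (x y : M) : x ≤ x + y := by
  have h := add_mono' 0 y x (zero_le' y)
  rwa [zero_add, add_comm] at h

theorem add_le_add {x y z w : M} (h : x ≤ y) (k : z ≤ w) : x + z ≤ y + w := by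
  refine (add_mono' x y z h).trans ?_
  rw [add_comm y z, add_comm y w]
  exact add_mono' z w y k

/-- The interval `[0, a]` below an idempotent `a`, as an MV-algebra `A` with an order embedding
`e` onto `[0, a]` that preserves `⊕`, `0` and maps `1` to `a`. -/
theorem exists_chart {a : M} (ha : a + a = a) :
    ∃ (A : Type u) (_ : MVAlgebra A) (e : A → M),
      (∀ x y, e (x + y) = e x + e y) ∧ e 0 = 0 ∧ e 1 = a ∧
      (∀ x y, e x ≤ e y ↔ x ≤ y) ∧ ∀ z, z ≤ a → ∃ x, e x = z := by
  obtain ⟨A, hadd, hzero, hone, hlam⟩ := interval_mv a ha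
  refine ⟨Set.Icc (0 : M) a, A, Subtype.val, hadd, hzero, hone, fun x y => ?_,
    fun z hz => ⟨⟨z, zero_le' z, hz⟩, rfl⟩⟩
  constructor
  · intro h
    refine Subtype.ext ?_
    refine (hadd _ _).trans ((le_antisymm ?_ ?_ : _ = a).trans hone.symm)
    · exact (add_le_add (hlam x).1.1.2 (Set.mem_Icc.1 y.2).2).trans ha.le
    · calc a = (A.compl x).1 + x.1 := (hlam x).1.2.symm
        _ ≤ _ := add_le_add le_rfl h
  · intro h
    -- x = λ_a(x*) is the least z in [0, a] with z ⊕ x* = a, and y is such a z.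
    have h1 := (hlam (A.compl x)).2 (show y.1 ∈ _ from ⟨y.2, by
      rw [add_comm]
      exact (hadd _ _).symm.trans ((congrArg Subtype.val h).trans hone)⟩)
    rwa [A.compl_compl' x] at h1

theorem MV_sub_le {A : Type u} [MVAlgebra A] (x y z : A) : (xᶜ + y)ᶜ ≤ z ↔ x ≤ y + z := by
  rw [MVAlgebra.le_def, MVAlgebra.le_def, MVAlgebra.compl_compl', add_assoc]

/-- The difference is computed in some [0, a] containing x and y. To compare it with an arbitrary z,
pass to a larger [0, b] containing z: the difference formed there lies below x, hence already in [0,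
a], so minimality in [0, a] applies to it. -/
theorem exists_sub (x y : M) : ∃ w : M, ∀ z, w ≤ z ↔ x ≤ y + z := by
  obtain ⟨a, ha, hxy⟩ := exists_idem (x ⊔ y)
  obtain ⟨A, _, e, hadd, -, h1, hle, hsurj⟩ := exists_chart ha
  obtain ⟨p, rfl⟩ := hsurj x (le_sup_left.trans hxy)
  obtain ⟨q, rfl⟩ := hsurj y (le_sup_right.trans hxy)
  refine ⟨e (pᶜ + q)ᶜ, fun z => ⟨fun h => ?_, fun h => ?_⟩⟩
  · have h2 := (hle _ _).2 ((MV_sub_le p q _).1 le_rfl)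
    rw [hadd] at h2
    exact h2.trans (add_le_add le_rfl h)
  · obtain ⟨b, hb, hzb⟩ := exists_idem (a ⊔ z)
    obtain ⟨B, _, d, dadd, -, -, dle, dsurj⟩ := exists_chart hb
    have hab : a ≤ b := le_sup_left.trans hzb
    obtain ⟨p', hp⟩ := dsurj (e p) ((le_sup_left.trans hxy).trans hab)
    obtain ⟨q', hq⟩ := dsurj (e q) ((le_sup_right.trans hxy).trans hab)
    obtain ⟨z', rfl⟩ := dsurj z (le_sup_right.trans hzb)
    rw [← hp, ← hq, ← dadd, dle, ← MV_sub_le] at h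
    have h3 : d (p'ᶜ + q')ᶜ ≤ e p := by
      rw [← hp, dle, MV_sub_le, add_comm]
      exact MVAlgebra.le'_add _ _
    obtain ⟨r, hr⟩ := hsurj _ (h3.trans (le_sup_left.trans hxy))
    refine le_trans ?_ ((dle _ _).2 h)
    rw [← hr, hle, MV_sub_le, ← hle, hadd, hr, ← hp, ← hq, ← dadd, dle, ← MV_sub_le]

/-- The truncated difference `x ⊖ y`, the least `z` with `x ≤ y ⊕ z`. -/
noncomputable def diff (x y : M) : M := (exists_sub x y).choose

theorem diff_le {x y z : M} : diff x y ≤ z ↔ x ≤ y + z := (exists_sub x y).choose_spec z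

/-- The Łukasiewicz product `x ⊙ y`. -/
noncomputable def odot (x y : M) : M := diff y (diff (x + y) x)

theorem diff_eq_zero {x y : M} : diff x y = 0 ↔ x ≤ y := by
  rw [← (zero_le' (diff x y)).ge_iff_eq', diff_le, add_zero]

theorem diff_le_left (x y : M) : diff x y ≤ x := by
  rw [diff_le, add_comm]
  exact le_add_right _ _

theorem odot_le_right (x y : M) : odot x y ≤ y := diff_le_left _ _

/-- The operations on any three elements of `M` are computed in an MV-algebra, as long as no
complements are taken. -/
theorem exists_chart_three (x y z : M) :
    ∃ (A : Type u) (_ : MVAlgebra A) (e : A → M),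
      (∀ p q, e p + e q = e (p + q)) ∧ e 0 = 0 ∧ (∀ p q, e p ≤ e q ↔ p ≤ q) ∧
      (∀ p q, diff (e p) (e q) = e (pᶜ + q)ᶜ) ∧
      (∀ p q, odot (e p) (e q) = e (pᶜ + qᶜ)ᶜ) ∧ (∀ p w, w ≤ e p → ∃ q, e q = w) ∧
      (∃ p, e p = x) ∧ (∃ p, e p = y) ∧ ∃ p, e p = z := by
  obtain ⟨a, ha, hxyz⟩ := exists_idem (x ⊔ y ⊔ z)
  obtain ⟨A, _, e, hadd, h0, h1, hle, hsurj⟩ := exists_chart ha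
  have hle1 : ∀ p, e p ≤ a := fun p => by
    rw [← h1, hle]
    exact MVAlgebra.add_one' _
  have hlow : ∀ p w, w ≤ e p → ∃ q, e q = w := fun p w hw => hsurj w (hw.trans (hle1 p))
  have hdiff : ∀ p q, diff (e p) (e q) = e (pᶜ + q)ᶜ := fun p q => by
    apply le_antisymm
    · rw [diff_le, ← hadd, hle, ← MV_sub_le]
    · obtain ⟨r, hr⟩ := hlow p _ (diff_le_left (e p) (e q))
      rw [← hr, hle, MV_sub_le, ← hle, hadd, hr, ← diff_le]
  refine ⟨A, _, e, fun p q => (hadd p q).symm, h0, hle, hdiff, fun p q => ?_, hlow,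
    hsurj x ((le_sup_left.trans le_sup_left).trans hxyz),
    hsurj y ((le_sup_right.trans le_sup_left).trans hxyz), hsurj z (le_sup_right.trans hxyz)⟩
  -- (p ⊕ q) ⊖ p = q ∧ p*, and subtracting this from q leaves q ⊙ p.
  have h := MVAlgebra.luk p qᶜ
  rw [MVAlgebra.compl_compl'] at h
  unfold odot
  rw [← hadd, hdiff, hdiff, add_comm (p + q)ᶜ p, h, MVAlgebra.le'_eq (MVAlgebra.le'_add _ _),
    add_comm]

theorem diff_diff (x y z : M) : diff (diff x y) z = diff x (y + z) :=
  eq_of_forall_ge_iff fun w => by rw [diff_le, diff_le, diff_le, add_assoc]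

theorem odot_comm (x y : M) : odot x y = odot y x := by
  obtain ⟨A, _, e, -, -, -, -, ho, -, ⟨p, rfl⟩, ⟨q, rfl⟩, -⟩ := exists_chart_three x y x
  rw [ho, ho, add_comm]

theorem odot_assoc (x y z : M) : odot (odot x y) z = odot x (odot y z) := by
  obtain ⟨A, _, e, -, -, -, -, ho, -, ⟨p, rfl⟩, ⟨q, rfl⟩, r, rfl⟩ := exists_chart_three x y z
  simp only [ho, MVAlgebra.compl_compl', add_assoc]

theorem diff_odot (x y z : M) : odot (diff x y) z = diff (odot x z) y := by
  obtain ⟨A, _, e, -, -, -, hd, ho, -, ⟨p, rfl⟩, ⟨q, rfl⟩, r, rfl⟩ := exists_chart_three x y z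
  simp only [ho, hd, MVAlgebra.compl_compl', add_right_comm]

theorem add_diff (x y : M) : x + diff y x = x ⊔ y := by
  -- The chart is only known to preserve the order, so the join is given a preimage t through the
  -- third slot and compared by its universal property.
  obtain ⟨A, _, e, ha, -, hle, hd, -, hlow, ⟨p, rfl⟩, ⟨q, rfl⟩, t, ht⟩ :=
    exists_chart_three x y (x ⊔ y)
  apply le_antisymm
  · rw [hd, ha, ← ht, hle, add_comm]
    refine MVAlgebra.sup_le' ?_ ?_
    · exact (hle q t).1 (ht ▸ le_sup_right)
    · exact (hle p t).1 (ht ▸ le_sup_left)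
  · exact sup_le (le_add_right _ _) (diff_le.1 le_rfl)

theorem diff_diff_self (x y : M) : diff x (diff x y) = x ⊓ y := by
  obtain ⟨A, _, e, -, -, hle, hd, -, -, ⟨p, rfl⟩, ⟨q, rfl⟩, t, ht⟩ :=
    exists_chart_three x y (x ⊓ y)
  have h : e (pᶜ + (pᶜ + q)ᶜ)ᶜ = e (p ⊓ q) := rfl
  rw [hd, hd, h]
  apply le_antisymm
  · exact le_inf ((hle _ _).2 inf_le_left) ((hle _ _).2 inf_le_right)
  · rw [← ht, hle, le_inf_iff, ← hle, ← hle, ht]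
    exact ⟨inf_le_left, inf_le_right⟩

theorem add_diff_cancel_left (x y : M) : diff (x + y) x = diff y (odot y x) := by
  obtain ⟨A, _, e, ha, -, -, hd, ho, -, ⟨p, rfl⟩, ⟨q, rfl⟩, -⟩ := exists_chart_three x y x
  have h := MVAlgebra.luk p qᶜ
  rw [MVAlgebra.compl_compl'] at h
  rw [ha, hd, ho, hd, add_comm _ p, h]

/-- c is the complement of y in an interval containing s and y. It replaces the bound y* of N by a
bound inside M. -/
theorem exists_annihilator (s y : M) : ∃ c : M, ∀ x, x ≤ s → (odot x y = 0 ↔ x ≤ c) := by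
  obtain ⟨A, _, e, -, h0, hle, -, ho, hlow, ⟨p, rfl⟩, ⟨q, rfl⟩, -⟩ := exists_chart_three s y s
  refine ⟨e qᶜ, fun x hx => ?_⟩
  obtain ⟨r, rfl⟩ := hlow p x hx
  rw [← (zero_le' (odot (e r) (e q))).ge_iff_eq', ho, ← h0, hle, hle, MV_sub_le, add_zero]

end Difference

/-! ### The MV-algebra N = M ∪ M* -/

/-- The underlying set `M ∪ {y* | y ∈ M}` of the MV-algebra generated by `M`. -/
inductive Unitization (M : Type u) : Type u
  | of (x : M) : Unitization M
  | co (y : M) : Unitization M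

namespace Unitization

variable {M : Type u}

/-- The complement of the unitization. -/
def star : Unitization M → Unitization M
  | of x => co x
  | co x => of x

instance : Compl (Unitization M) := ⟨star⟩

theorem compl_of (x : M) : (of x)ᶜ = co x := rfl
theorem compl_co (x : M) : (co x)ᶜ = of x := rfl

variable [EMVAlgebra M]

/-- The operation `⊕` of the unitization. -/
noncomputable def oplus : Unitization M → Unitization M → Unitization M
  | of x, of y => of (x + y)
  | of x, co y => co (diff y x)
  | co x, of y => co (diff x y)
  | co x, co y => co (odot x y)

noncomputable instance : Zero (Unitization M) := ⟨of 0⟩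
noncomputable instance : One (Unitization M) := ⟨co 0⟩
noncomputable instance : Add (Unitization M) := ⟨oplus⟩

theorem of_add_of (x y : M) : of x + of y = of (x + y) := rfl
theorem of_add_co (x y : M) : of x + co y = co (diff y x) := rfl
theorem co_add_of (x y : M) : co x + of y = co (diff x y) := rfl
theorem co_add_co (x y : M) : co x + co y = co (odot x y) := rfl
theorem zero_def : (0 : Unitization M) = of 0 := rfl
theorem one_def : (1 : Unitization M) = co 0 := rfl

theorem oplus_comm (u v : Unitization M) : u + v = v + u := by
  cases u <;> cases v <;>
    simp only [of_add_of, of_add_co, co_add_of, co_add_co, add_comm, odot_comm]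

theorem zero_oplus (u : Unitization M) : 0 + u = u := by
  cases u with
  | of x => rw [zero_def, of_add_of, zero_add]
  | co x =>
    rw [zero_def, of_add_co]
    exact congrArg co (eq_of_forall_ge_iff fun w => by rw [diff_le, zero_add])

theorem oplus_assoc (u v w : Unitization M) : u + v + w = u + (v + w) := by
  rcases u with x | x <;> rcases v with y | y <;> rcases w with z | z <;>
    simp only [of_add_of, of_add_co, co_add_of, co_add_co]
  · rw [add_assoc]
  · rw [diff_diff, add_comm]
  · rw [diff_diff, diff_diff, add_comm]
  · rw [diff_odot]
  · rw [diff_diff]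
  · rw [diff_odot, odot_comm, ← diff_odot, odot_comm]
  · rw [odot_comm x (diff y z), diff_odot, odot_comm]
  · rw [odot_assoc]

noncomputable instance : MVAlgebra (Unitization M) where
  add_assoc := oplus_assoc
  zero_add := zero_oplus
  add_zero u := by rw [oplus_comm, zero_oplus]
  add_comm := oplus_comm
  nsmul := nsmulRec
  compl_compl' u := by cases u <;> rfl
  compl_zero' := rfl
  add_one' u := by
    cases u with
    | of x => exact congrArg co (diff_eq_zero.2 (zero_le' x))
    | co x => exact congrArg co (le_antisymm (odot_le_right _ _) (zero_le' _))
  luk u v := by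
    rcases u with x | x <;> rcases v with y | y <;>
      simp only [of_add_of, of_add_co, co_add_of, co_add_co, compl_of, compl_co]
    · rw [add_diff, add_diff, sup_comm]
    · rw [add_diff_cancel_left]
    · rw [add_diff_cancel_left]
    · rw [diff_diff_self, diff_diff_self, inf_comm]

/-! ### Order of N, and M as a maximal ideal -/

theorem co_eq_one_iff {x : M} : co x = 1 ↔ x = 0 := by
  rw [one_def, co.injEq]

theorem of_le_of {x y : M} : of x ≤ of y ↔ x ≤ y := by
  rw [MVAlgebra.le_def, compl_of, co_add_of, co_eq_one_iff, diff_eq_zero]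

theorem of_le_co {x y : M} : of x ≤ co y ↔ odot x y = 0 := by
  rw [MVAlgebra.le_def, compl_of, co_add_co, co_eq_one_iff]

theorem co_le_co {x y : M} : co x ≤ co y ↔ y ≤ x := by
  rw [MVAlgebra.le_def, compl_co, of_add_co, co_eq_one_iff, diff_eq_zero]

theorem not_co_le_of {x y : M} : ¬ co x ≤ of y := by
  rw [MVAlgebra.le_def, compl_co, of_add_of, one_def]
  exact nofun

theorem exists_of_le_of {u : Unitization M} {y : M} (h : u ≤ of y) : ∃ x, x ≤ y ∧ of x = u := by
  cases u with
  | of x => exact ⟨x, of_le_of.1 h, rfl⟩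
  | co x => exact absurd h not_co_le_of

/-- For `map_lam`: M is a lower set of N, so [0, b] is the same interval in both, and so is the
minimum defining λ_b. -/
theorem isHom_of : IsHom (of : M → Unitization M) where
  map_sup x y := by
    rw [MVAlgebra.sup_def, compl_of, co_add_of, compl_co, of_add_of, add_comm, add_diff, sup_comm]
  map_inf x y := by
    rw [MVAlgebra.inf_def, compl_of, co_add_of, compl_co, co_add_of, compl_co, diff_diff_self]
  map_add _ _ := rfl
  map_zero := rfl
  map_lam b x hb hx := by
    have h := lam_isLeast hb hx
    have k := lam_isLeast (a := of b) (x := of x) (congrArg of hb) (of_le_of.2 hx)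
    refine IsLeast.unique (a := of (lam b x)) (b := lam (of b) (of x))
      (s := {z | z ∈ Set.Icc 0 (of b) ∧ z + of x = of b})
      ⟨⟨⟨zero_le' _, of_le_of.2 h.1.1.2⟩, congrArg of h.1.2⟩, ?_⟩ k
    rintro z ⟨⟨-, hz⟩, hzx⟩
    obtain ⟨w, hw, rfl⟩ := exists_of_le_of hz
    rw [of_add_of, of.injEq] at hzx
    exact of_le_of.2 (h.2 ⟨⟨zero_le' w, hw⟩, hzx⟩)

theorem isIdeal_range_of : IsIdeal (Set.range (of : M → Unitization M)) where
  nonempty := ⟨of 0, 0, rfl⟩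
  mem_of_le := by
    rintro x _ h ⟨y, rfl⟩
    obtain ⟨w, -, rfl⟩ := exists_of_le_of h
    exact ⟨w, rfl⟩
  add_mem := by
    rintro _ _ ⟨x, rfl⟩ ⟨y, rfl⟩
    exact ⟨x + y, rfl⟩

theorem isMaximalIdeal_range_of : IsMaximalIdeal (Set.range (of : M → Unitization M)) := by
  refine ⟨⟨isIdeal_range_of, fun h => ?_⟩, ?_⟩
  · obtain ⟨x, hx⟩ := h.ge (Set.mem_univ (co 0))
    exact nomatch hx
  · rintro J ⟨hJ, hne⟩ hsub (x | y) hu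
    · exact ⟨x, rfl⟩
    · refine absurd (Set.eq_univ_of_forall fun v => ?_) hne
      -- An ideal containing M and one y* contains y ⊕ y* = 1.
      have h := hJ.add_mem _ _ (hsub ⟨y, rfl⟩) hu
      rw [← compl_of, MVAlgebra.add_compl] at h
      exact hJ.mem_of_le v 1 (MVAlgebra.add_one' _) h

/-! ### Countable suprema in N -/

/-- Only upper bounds of the form y* are new in N; below s, such a bound amounts to the bound c of
`exists_annihilator`. -/
theorem isLUB_range_of {x : ℕ → M} {s : M} (h : IsLUB (Set.range x) s) :
    IsLUB (Set.range fun n => of (x n)) (of s) := by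
  refine ⟨?_, ?_⟩
  · rintro _ ⟨n, rfl⟩
    exact of_le_of.2 (h.1 ⟨n, rfl⟩)
  · rintro (y | y) hy
    · refine of_le_of.2 (h.2 ?_)
      rintro _ ⟨n, rfl⟩
      exact of_le_of.1 (hy ⟨n, rfl⟩)
    · obtain ⟨c, hc⟩ := exists_annihilator s y
      refine of_le_co.2 ((hc s le_rfl).2 (h.2 ?_))
      rintro _ ⟨n, rfl⟩
      exact (hc _ (h.1 ⟨n, rfl⟩)).1 (of_le_co.1 (hy ⟨n, rfl⟩))

theorem isSigmaIdeal_range_of (hσ : SigmaComplete M) :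
    IsSigmaIdeal (Set.range (of : M → Unitization M)) := by
  refine ⟨isIdeal_range_of, fun x hx s hs => ?_⟩
  choose y hy using hx
  obtain ⟨t, ht⟩ := hσ y
  obtain rfl : (fun n => of (y n)) = x := funext hy
  exact ⟨t, (isLUB_range_of ht).unique hs⟩

/-- De Morgan in [0, y]: the infimum is y ⊖ ⋁ (y ⊖ z n). -/
theorem exists_isGLB_of_le (hσ : SigmaComplete M) {z : ℕ → M} {y : M} (hz : ∀ n, z n ≤ y) :
    ∃ w, IsGLB (Set.range z) w := by
  obtain ⟨s, hs⟩ := hσ fun n => diff y (z n)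
  refine ⟨diff y s, ?_, fun w hw => ?_⟩
  · rintro _ ⟨n, rfl⟩
    rw [diff_le, add_comm, ← diff_le]
    exact hs.1 ⟨n, rfl⟩
  · have hwy : w ≤ y := (hw ⟨0, rfl⟩).trans (hz 0)
    have hsw : s ≤ diff y w := by
      refine hs.2 ?_
      rintro _ ⟨n, rfl⟩
      rw [diff_le]
      exact (diff_le.1 le_rfl).trans (add_le_add (hw ⟨n, rfl⟩) le_rfl)
    calc w = diff y (diff y w) := by rw [diff_diff_self, inf_eq_right.2 hwy]
      _ ≤ diff y s := by
        rw [diff_le]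
        exact (diff_le.1 le_rfl).trans (add_le_add hsw le_rfl)

theorem sigmaComplete (hσ : SigmaComplete M) : SigmaComplete (Unitization M) := by
  intro u
  by_cases hu : ∀ n, ∃ x, of x = u n
  · choose x hx using hu
    obtain ⟨s, hs⟩ := hσ x
    obtain rfl : (fun n => of (x n)) = u := funext hx
    exact ⟨of s, isLUB_range_of hs⟩
  · push Not at hu
    obtain ⟨k, hk⟩ := hu
    obtain ⟨y, hy⟩ : ∃ y, u k = co y := by
      cases h : u k with
      | of x => exact absurd h.symm (hk x)
      | co y => exact ⟨y, rfl⟩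
    -- Since y* is a term of the sequence, joining every term with it keeps the upper bounds and
    -- turns all terms into complements of elements below y.
    have hv : ∀ n, ∃ z, z ≤ y ∧ co z = u n ⊔ co y := fun n => by
      have h : co y ≤ u n ⊔ co y := le_sup_right
      cases hz : u n ⊔ co y with
      | of x => exact absurd (hz ▸ h) not_co_le_of
      | co z => exact ⟨z, co_le_co.1 (hz ▸ h), rfl⟩
    choose z hzy hz using hv
    obtain ⟨w, hw⟩ := exists_isGLB_of_le hσ hzy
    refine ⟨co w, ?_, fun t ht => ?_⟩
    · rintro _ ⟨n, rfl⟩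
      refine le_trans (le_sup_left.trans (hz n).ge) (co_le_co.2 (hw.1 ⟨n, rfl⟩))
    · have hyt : co y ≤ t := hy ▸ ht ⟨k, rfl⟩
      cases t with
      | of x => exact absurd hyt not_co_le_of
      | co t =>
        refine co_le_co.2 (hw.2 ?_)
        rintro _ ⟨n, rfl⟩
        rw [← co_le_co, hz]
        exact sup_le (ht ⟨n, rfl⟩) hyt

end Unitization

end EMVAlgebra

theorem mainTheorem2 {M : Type u} [EMVAlgebra M] (hσ : EMVAlgebra.SigmaComplete M)
    (htop : ¬ ∃ t : M, ∀ x : M, x ≤ t) :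
    ∃ (N : Type u) (_ : MVAlgebra N) (f : M → N),
      EMVAlgebra.SigmaComplete N ∧
      Function.Injective f ∧ EMVAlgebra.IsHom f ∧
      EMVAlgebra.IsMaximalIdeal (Set.range f) ∧
      EMVAlgebra.IsSigmaIdeal (Set.range f) ∧
      ∀ x : N, x ∈ Set.range f ∨ ∃ y : M, x = EMVAlgebra.lam 1 (f y) := by
  refine ⟨EMVAlgebra.Unitization M, inferInstance, EMVAlgebra.Unitization.of,
    EMVAlgebra.Unitization.sigmaComplete hσ, fun _ _ h => EMVAlgebra.Unitization.of.inj h,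
    EMVAlgebra.Unitization.isHom_of, EMVAlgebra.Unitization.isMaximalIdeal_range_of,
    EMVAlgebra.Unitization.isSigmaIdeal_range_of hσ, ?_⟩
  rintro (x | y)
  · exact Or.inl ⟨x, rfl⟩
  · exact Or.inr ⟨y, (MVAlgebra.lam_one (EMVAlgebra.Unitization.of y)).symm⟩
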